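/- For $H$ a real Hilbert space and $g\colon H\to\,]-\infty,+\infty]$, write $\operatorname{dom} g=\{x : g(x)<+\infty\}$, $\operatorname{epi} g=\{(x,\delta)\in H\times\mathbb R : g(x)\le\delta\}$, $g^*(u)=\sup_{x}(\langle x,u\rangle-g(x))$, $\iota_C$ for the indicator function of a set $C$ ($0$ on $C$, $+\infty$ outside $C$), $\operatorname{prox}_g x$ for the unique minimizer of $y\mapsto g(y)+\frac12\|x-y\|^2$, and $P_C=\operatorname{prox}_{\iota_C}$ for the projection onto $C$; products carry the Hilbert direct sum norm. $\Gamma_0(H)$ is the class of proper lower semicontinuous convex functions from $H$ to $]-\infty,+\infty]$. For $f\in\Gamma_0(H)$, $(\operatorname{rec} f)(x)=\lim_{t\to+\infty}\frac{f(x_0+tx)-f(x_0)}{t}$ (for any $x_0\in\operatorname{dom} f$), and the perspective of $f$ is $$\widetilde f(x,\eta)=\begin{cases}\eta f(x/\eta),&\eta>0;\\ (\operatorname{rec} f)(x),&\eta=0;\\ +\infty,&\eta<0.\end{cases}$$ $W\colon[-1/e,+\infty[\,\to[-1,+\infty[$ is the principal branch of the Lambert W-function, i.e. the inverse of $\xi\mapsto\xi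 e^{\xi}$ on $[-1,+\infty[$. Let $f\colon\mathbb R\to\mathbb R$, $f(\xi)=e^\xi$. Then: 1. $f\in\Gamma_0(\mathbb R)$, the limit defining $\operatorname{rec} f$ exists for all $x_0,x\in\mathbb R$ and does not depend on $x_0$, $\operatorname{rec} f=\iota_{]-\infty,0]}$, and $\widetilde f(x,\eta)$ equals $\eta e^{x/\eta}$ if $\eta>0$, $\iota_{]-\infty,0]}(x)$ if $\eta=0$, and $+\infty$ if $\eta<0$. Moreover $\operatorname{epi}\widetilde f$ is the exponential cone $$\mathcal K_{\exp}=\{(x,\eta,\delta)\in\mathbb R^3:\eta>0,\ \eta e^{x/\eta}\le\delta\}\cup\big(\,]-\infty,0]\times\{0\}\times[0,+\infty[\,\big).$$ 2. $D:=\overline{\operatorname{dom}}\,\widetilde f=\mathbb R\times[0,+\infty[$, $P_D(x,\eta)=(x,\max\{0,\eta\})$, and $\widetilde f(P_D(x,\eta))$ equals $\eta e^{x/\eta}$ if $\eta>0$, $0$ if $\eta\le0$ and $x\le 0$, and $+\infty$ if $\eta\le 0$ and $x>0$. In particular, for $\delta\in\mathbb R$, $\widetilde f(P_D(x,\eta))\le\delta$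 if and only if ($\eta>0$ and $\eta e^{x/\eta}\le\delta$) or ($\eta\le0$, $x\le0$ and $0\le\delta$). 3. For every $(x,\eta,\delta)\in\mathbb R^3$ the projection $P_{\operatorname{epi}\widetilde f}(x,\eta,\delta)$ exists, and $$P_{\operatorname{epi}\widetilde f}(x,\eta,\delta)=\begin{cases}(x,0,\delta),&\text{if }\eta\le0,\ x\le0\text{ and }0\le\delta;\\ (x,\eta,\delta),&\text{if }\eta>0\text{ and }\eta e^{x/\eta}\le\delta;\\ (\operatorname{prox}_{\mu\widetilde f}(x,\eta),\delta+\mu),&\text{otherwise,}\end{cases}$$ where, in the last case, $\mu\in\,]0,-\delta+\widetilde f(P_D(x,\eta))]\cap\mathbb R$ is the unique solution in $]0,+\infty[$ of $\mu+\delta-\widetilde f(\operatorname{prox}_{\mu\widetilde f}(x,\eta))=0$. 4. $f^*(\xi)$ equals $\xi(\ln\xi-1)$ if $\xi>0$, $0$ if $\xi=0$, and $+\infty$ if $\xi<0$; $\overline{\operatorname{dom}}\,f^*=[0,+\infty[$ and $P_{\overline{\operatorname{dom}} f^*}(\xi)=\max\{0,\xi\}$. For all $x,\eta\in\mathbb R$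 and $\mu>0$, $\eta+\mu f^*(P_{\overline{\operatorname{dom}} f^*}(x/\mu))\le0$ if and only if ($x\le0$ and $\eta\le0$) or ($x>0$ and $\mu\ge xe^{\eta/x-1}$). For all $x\in\mathbb R$ and $\gamma>0$, the following proximity operators exist and $$\operatorname{prox}_{\gamma f}(x)=x-W(\gamma e^x),\qquad f(\operatorname{prox}_{\gamma f}(x))=\tfrac1\gamma W(\gamma e^x),$$ $$\operatorname{prox}_{\gamma f^*}(x)=\gamma W\big(e^{x/\gamma}/\gamma\big),\qquad f^*(\operatorname{prox}_{\gamma f^*}(x))=(x-\gamma)W\big(e^{x/\gamma}/\gamma\big)-\gamma W\big(e^{x/\gamma}/\gamma\big)^2.$$ 5. For all $x,\eta\in\mathbb R$ and $\mu>0$, $\operatorname{prox}_{\mu\widetilde f}(x,\eta)$ exists and $$\operatorname{prox}_{\mu\widetilde f}(x,\eta)=\begin{cases}(0,0),&\text{if }x>0\text{ and }\mu\ge xe^{\eta/x-1};\\ (x,0),&\text{if }x\le0\text{ and }\eta\le0;\\ \big(x-\nu W(\tfrac\mu\nu e^{x/\nu}),\nu\big),&\text{otherwise,}\end{cases}$$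 and $\widetilde f(\operatorname{prox}_{\mu\widetilde f}(x,\eta))$ equals $0$ in the first two cases and $\frac{\nu^2}{\mu}W(\frac\mu\nu e^{x/\nu})$ in the third, where $\nu$ is the unique solution in $]0,+\infty[$ of $$\nu=\eta+(x-\nu)W\big(\tfrac\mu\nu e^{x/\nu}\big)-\nu\,W\big(\tfrac\mu\nu e^{x/\nu}\big)^2;$$ it lies in $]0,\eta+x(\ln(x/\mu)-1)]$ if $x>0$ and in $]0,\eta]$ if $x\le0$. -/

import Mathlib

open Set Filter Topology

noncomputable section

namespace PerspEpi

/-- The Hilbert direct sum of two spaces: pairs with the norm `‖(a, b)‖² = ‖a‖² + ‖b‖²`. -/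
abbrev HilbertSum (E F : Type*) := WithLp 2 (E × F)

/-- The element `(a, b)` of the Hilbert direct sum. -/
abbrev pair {E F : Type*} (a : E) (b : F) : HilbertSum E F := WithLp.toLp 2 (a, b)

/-- The (effective) domain of an extended-real-valued function. -/
def dom {E : Type*} (g : E → EReal) : Set E := {x | g x < ⊤}

/-- The epigraph of `g`, as a subset of the Hilbert direct sum of `E` and `ℝ`. -/
def epi {E : Type*} (g : E → EReal) : Set (HilbertSum E ℝ) :=
  {z | g z.fst ≤ ((z.snd : ℝ) : EReal)}

/-- The class `Γ₀(H)`: proper lower semicontinuous convex functions with values in `]-∞, +∞]`. -/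
structure IsGammaZero {H : Type*} [NormedAddCommGroup H] [InnerProductSpace ℝ H]
    (f : H → EReal) : Prop where
  ne_bot : ∀ x, f x ≠ ⊥
  proper : (dom f).Nonempty
  lsc : LowerSemicontinuous f
  convex : ∀ x y : H, ∀ a b : ℝ, 0 < a → 0 < b → a + b = 1 →
    f (a • x + b • y) ≤ (a : EReal) * f x + (b : EReal) * f y

/-- The indicator function `ι_C`: `0` on `C` and `+∞` outside `C`. -/
def indicatorFun {E : Type*} (C : Set E) (x : E) : EReal :=
  open Classical in if x ∈ C then 0 else ⊤

/-- The recession function: `(rec f)(x) = lim_{t → +∞} (f (x₀ + t x) - f x₀) / t`, `x₀ ∈ dom f`.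
For `f ∈ Γ₀(H)` the limit exists and does not depend on `x₀`; the supremum and the upper limit
below only make the definition total. -/
def recession {H : Type*} [NormedAddCommGroup H] [InnerProductSpace ℝ H]
    (f : H → EReal) (x : H) : EReal :=
  ⨆ x₀ ∈ dom f, limsup (fun t : ℝ => (f (x₀ + t • x) - f x₀) / (t : EReal)) atTop

/-- The perspective `f̃` of `f`. -/
def perspective {H : Type*} [NormedAddCommGroup H] [InnerProductSpace ℝ H]
    (f : H → EReal) (z : HilbertSum H ℝ) : EReal :=
  if 0 < z.snd then ((z.snd : ℝ) : EReal) * f (z.snd⁻¹ • z.fst)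
  else if z.snd = 0 then recession f z.fst
  else ⊤

/-- The Fenchel conjugate `f^*(u) = sup_x (⟨x, u⟩ - f x)`. -/
def conjugate {H : Type*} [NormedAddCommGroup H] [InnerProductSpace ℝ H]
    (f : H → EReal) (u : H) : EReal :=
  ⨆ x : H, ((inner ℝ x u : ℝ) : EReal) - f x

/-- The function `γ g`, for a real number `γ`. -/
def scaled {E : Type*} (γ : ℝ) (g : E → EReal) (x : E) : EReal := (γ : EReal) * g x

/-- `p` is the unique minimizer of `y ↦ g y + ‖x - y‖² / 2`. -/
def IsProx {E : Type*} [NormedAddCommGroup E] (g : E → EReal) (x p : E) : Prop :=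
  ∀ y : E, y ≠ p →
    g p + ((‖x - p‖ ^ 2 / 2 : ℝ) : EReal) < g y + ((‖x - y‖ ^ 2 / 2 : ℝ) : EReal)

/-- The proximity operator `prox_g x = argmin_y (g y + ‖x - y‖² / 2)`
(an arbitrary value if there is no unique minimizer). -/
def prox {E : Type*} [NormedAddCommGroup E] (g : E → EReal) (x : E) : E :=
  Classical.epsilon (IsProx g x)

theorem IsProx.prox_eq {E : Type*} [NormedAddCommGroup E] {g : E → EReal} {x p : E}
    (h : IsProx g x p) : prox g x = p := by
  by_contra hne
  have h2 : IsProx g x (prox g x) := Classical.epsilon_spec (p := IsProx g x) ⟨p, h⟩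
  exact lt_asymm (h _ hne) (h2 p (Ne.symm hne))

/-- The projection onto `C` is the proximity operator of the indicator function of `C`. -/
def proj {E : Type*} [NormedAddCommGroup E] (C : Set E) : E → E := prox (indicatorFun C)

/-- Being the `prox` of an indicator function means being the unique nearest
point of the set. -/
theorem isProx_indicatorFun_iff {E : Type*} [NormedAddCommGroup E] {C : Set E} (hC : C.Nonempty)
    {x p : E} :
    IsProx (indicatorFun C) x p ↔ p ∈ C ∧ ∀ y ∈ C, y ≠ p → ‖x - p‖ < ‖x - y‖ := by
  have key : ∀ y, ‖x - p‖ ^ 2 / 2 < ‖x - y‖ ^ 2 / 2 ↔ ‖x - p‖ < ‖x - y‖ := fun y => by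
    rw [div_lt_div_iff_of_pos_right (by norm_num : (0 : ℝ) < 2),
      sq_lt_sq₀ (norm_nonneg _) (norm_nonneg _)]
  constructor
  · intro h
    have hp : p ∈ C := by
      by_contra hp
      obtain ⟨q, hq⟩ := hC
      have := h q (fun e => hp (e ▸ hq))
      simp [indicatorFun, hp] at this
    refine ⟨hp, fun y hy hne => ?_⟩
    have := h y hne
    simp only [indicatorFun, hp, hy, if_true, zero_add, EReal.coe_lt_coe_iff] at this
    exact (key y).1 this
  · rintro ⟨hp, h⟩ y hne
    by_cases hy : y ∈ C
    · simp only [indicatorFun, hp, hy, if_true, zero_add, EReal.coe_lt_coe_iff]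
      exact (key y).2 (h y hy hne)
    · simp only [indicatorFun, hp, hy, if_true, if_false, zero_add, EReal.top_add_coe]
      exact EReal.coe_lt_top _

/-- The exponential function, as a function with values in `]-∞, +∞]`. -/
def expFun (ξ : ℝ) : EReal := ((Real.exp ξ : ℝ) : EReal)

/-- The exponential cone. -/
def expCone : Set (HilbertSum (HilbertSum ℝ ℝ) ℝ) :=
  {z | ∃ x η δ : ℝ, z = pair (pair x η) δ ∧
    ((0 < η ∧ η * Real.exp (x / η) ≤ δ) ∨ (x ≤ 0 ∧ η = 0 ∧ 0 ≤ δ))}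

/-- The principal branch of the Lambert W-function: the inverse of the function
`ξ ↦ ξ e^ξ` on `[-1, +∞[`, defined on `[-1/e, +∞[` (with irrelevant values elsewhere). -/
def lambertW : ℝ → ℝ := Function.invFunOn (fun ξ : ℝ => ξ * Real.exp ξ) (Ici (-1))

theorem strictMonoOn_mul_exp : StrictMonoOn (fun ξ : ℝ => ξ * Real.exp ξ) (Ici (-1)) := by
  refine strictMonoOn_of_deriv_pos (convex_Ici _) (by fun_prop) fun x hx => ?_
  rw [interior_Ici, mem_Ioi] at hx
  have h : HasDerivAt (fun ξ : ℝ => ξ * Real.exp ξ) (1 * Real.exp x + x * Real.exp x) x :=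
    (hasDerivAt_id x).mul (Real.hasDerivAt_exp x)
  rw [h.deriv, ← add_mul]
  exact mul_pos (by linarith) (Real.exp_pos x)

theorem lambertW_spec {y : ℝ} (hy : -Real.exp (-1) ≤ y) :
    -1 ≤ lambertW y ∧ lambertW y * Real.exp (lambertW y) = y := by
  have hex : ∃ a ∈ Ici (-1 : ℝ), (fun ξ : ℝ => ξ * Real.exp ξ) a = y := by
    have hb : (-1 : ℝ) ≤ |y| := le_trans (by norm_num) (abs_nonneg y)
    have hc : ContinuousOn (fun ξ : ℝ => ξ * Real.exp ξ) (Icc (-1) |y|) := by fun_prop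
    have hmem : y ∈ Icc ((-1 : ℝ) * Real.exp (-1)) (|y| * Real.exp |y|) := by
      refine ⟨by linarith, (le_abs_self y).trans ?_⟩
      exact le_mul_of_one_le_right (abs_nonneg y) (Real.one_le_exp (abs_nonneg y))
    obtain ⟨a, ha, h⟩ := intermediate_value_Icc hb hc hmem
    exact ⟨a, ha.1, h⟩
  exact ⟨Function.invFunOn_mem hex, Function.invFunOn_eq hex⟩

theorem lambertW_mul_exp {ξ : ℝ} (hξ : -1 ≤ ξ) : lambertW (ξ * Real.exp ξ) = ξ :=
  strictMonoOn_mul_exp.injOn.leftInvOn_invFunOn hξ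

end PerspEpi

end

namespace PerspEpi

/-! Every explicit proximity operator is certified by a subgradient inequality: if `w - p` is a
subgradient of `g` at `p`, then `p` is the unique minimizer (`isProx_of_subgradient`). The tangent
inequality of the exponential supplies the subgradients. On the half-space `η ≥ 0` the perspective
dominates the linear forms `e^s (x + (1 - s) η)`, and its epigraph is cut out by these together with
`η ≥ 0`; hence the epigraph is closed and convex.

The perspective is positively homogeneous, so `p` is its prox at `w` as soon as `w - p` lies below
`μ f̃` as a linear form, with equality at `p`. With `p = (νs, ν)` and `ν > 0` this reads `x = νs + μ
e^s`, `η = ν + μ e^s (1 - s)`. Eliminating `ν` leaves one equation in `s`, solved by the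
intermediate value theorem (`exists_slope`); the substitution `W = (μ/ν) e^s` turns the system into
the Lambert equation for `ν` (`exists_slope_iff`).

The projection `(q, ρ)` of `(x, η, δ)` onto the epigraph satisfies a normal cone inequality. Either
`ρ = δ`, and then `q` is the projection onto the closed domain, or `μ = ρ - δ > 0` and `q` is the
prox of `μ f̃` (`exists_isProx_scaled_epi`). Conversely, every positive solution of the equation for
`μ` yields the projection (`isProx_epi_of_isProx_scaled`). Uniqueness of `ν` and of `μ` is thus
inherited from uniqueness of the prox and of the projection. -/

/-! ### Subgradient criteria for proximity operators and projections. -/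

/-- Expanding `‖w - y‖²` about `p` cancels the inner product and leaves the surplus `‖y - p‖² / 2`,
which makes the inequality strict. -/
theorem isProx_of_subgradient {E : Type*} [NormedAddCommGroup E] [InnerProductSpace ℝ E]
    {g : E → EReal} {w p : E} {c : ℝ} (hp : g p = (c : EReal))
    (h : ∀ z, ((c + inner ℝ (w - p) (z - p) : ℝ) : EReal) ≤ g z) : IsProx g w p := by
  intro y hy
  have hpos : 0 < ‖y - p‖ ^ 2 := by
    have := norm_pos_iff.2 (sub_ne_zero.2 hy)
    positivity
  have hexp : ‖w - y‖ ^ 2 = ‖w - p‖ ^ 2 - 2 * inner ℝ (w - p) (y - p) + ‖y - p‖ ^ 2 := by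
    rw [← norm_sub_sq_real, sub_sub_sub_cancel_right]
  calc g p + ((‖w - p‖ ^ 2 / 2 : ℝ) : EReal)
      = ((c + ‖w - p‖ ^ 2 / 2 : ℝ) : EReal) := by rw [hp, EReal.coe_add]
    _ < ((c + inner ℝ (w - p) (y - p) + ‖w - y‖ ^ 2 / 2 : ℝ) : EReal) := by
        rw [EReal.coe_lt_coe_iff, hexp]; linarith
    _ = ((c + inner ℝ (w - p) (y - p) : ℝ) : EReal) + ((‖w - y‖ ^ 2 / 2 : ℝ) : EReal) :=
        EReal.coe_add _ _
    _ ≤ g y + ((‖w - y‖ ^ 2 / 2 : ℝ) : EReal) := add_le_add_left (h y) _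

theorem IsProx.isProx_prox {E : Type*} [NormedAddCommGroup E] {g : E → EReal} {x p : E}
    (h : IsProx g x p) : IsProx g x (prox g x) := by
  rwa [h.prox_eq]

theorem isProx_indicatorFun_of_inner_nonpos {E : Type*} [NormedAddCommGroup E]
    [InnerProductSpace ℝ E] {C : Set E} {w p : E} (hp : p ∈ C)
    (h : ∀ z ∈ C, inner ℝ (w - p) (z - p) ≤ 0) : IsProx (indicatorFun C) w p := by
  refine isProx_of_subgradient (c := 0) (by simp [indicatorFun, hp]) fun z => ?_
  by_cases hz : z ∈ C
  · simpa [indicatorFun, hz] using h z hz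
  · simp [indicatorFun, hz]

/-! ### The exponential function and its recession function. -/

theorem exp_subgradient (s t : ℝ) : Real.exp s * (1 + t - s) ≤ Real.exp t := by
  have h := mul_le_mul_of_nonneg_left (Real.add_one_le_exp (t - s)) (Real.exp_pos s).le
  rw [← Real.exp_add, add_sub_cancel] at h
  linarith

theorem isGammaZero_expFun : IsGammaZero expFun where
  ne_bot _ := EReal.coe_ne_bot _
  proper := ⟨0, EReal.coe_lt_top _⟩
  lsc := (continuous_coe_real_ereal.comp Real.continuous_exp).lowerSemicontinuous
  convex x y a b ha hb hab := by
    have := convexOn_exp.2 (mem_univ x) (mem_univ y) ha.le hb.le hab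
    simp only [expFun]
    exact_mod_cast this

theorem tendsto_recession_quotient (x₀ x : ℝ) :
    Tendsto (fun t : ℝ => (expFun (x₀ + t • x) - expFun x₀) / (t : EReal)) atTop
      (𝓝 (indicatorFun (Iic 0) x)) := by
  have hrw : (fun t : ℝ => (expFun (x₀ + t • x) - expFun x₀) / (t : EReal)) =
      fun t : ℝ => (((Real.exp (x₀ + t * x) - Real.exp x₀) / t : ℝ) : EReal) := by
    ext t
    simp only [expFun, smul_eq_mul, ← EReal.coe_sub, ← EReal.coe_div]
  rw [hrw]
  rcases le_or_gt x 0 with hx | hx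
  · simp only [indicatorFun, mem_Iic, hx, if_true]
    refine (continuous_coe_real_ereal.tendsto 0).comp ?_
    -- For `x ≤ 0` and `t > 0` both exponentials lie in `]0, e^{x₀}]`, so their difference stays
    -- bounded.
    refine squeeze_zero_norm' (a := fun t : ℝ => Real.exp x₀ * t⁻¹) ?_
      (by simpa using tendsto_inv_atTop_zero.const_mul (Real.exp x₀))
    filter_upwards [eventually_gt_atTop 0] with t ht
    rw [Real.norm_eq_abs, abs_div, abs_of_pos ht, div_eq_mul_inv]
    gcongr
    have h1 : Real.exp (x₀ + t * x) ≤ Real.exp x₀ :=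
      Real.exp_le_exp.2 (by nlinarith)
    rw [abs_le]
    constructor <;> linarith [Real.exp_pos x₀, Real.exp_pos (x₀ + t * x)]
  · simp only [indicatorFun, mem_Iic, hx.not_ge, if_false]
    refine EReal.tendsto_coe_nhds_top_iff.2 ?_
    -- The minorant is the quadratic term of `e^{tx} ≥ 1 + tx + (tx)²/2`, divided by `t`.
    refine tendsto_atTop_mono' atTop (f₁ := fun t : ℝ => Real.exp x₀ * x ^ 2 / 2 * t) ?_
      (tendsto_id.const_mul_atTop (by positivity))
    filter_upwards [eventually_gt_atTop 0] with t ht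
    have h := Real.quadratic_le_exp_of_nonneg (mul_pos ht hx).le
    rw [le_div_iff₀ ht, Real.exp_add]
    have h2 : 0 < Real.exp x₀ * (t * x) := by positivity
    nlinarith [mul_le_mul_of_nonneg_left h (Real.exp_pos x₀).le]

theorem recession_expFun : recession expFun = indicatorFun (Iic 0) := by
  ext x
  have hdom : dom expFun = univ := eq_univ_of_forall fun y => EReal.coe_lt_top _
  simp only [recession, (tendsto_recession_quotient _ x).limsup_eq, hdom, mem_univ, iSup_pos,
    iSup_const]

/-! ### The perspective, its epigraph and its domain. -/

theorem perspective_expFun (z : HilbertSum ℝ ℝ) : perspective expFun z =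
    if 0 < z.snd then ((z.snd * Real.exp (z.fst / z.snd) : ℝ) : EReal)
    else if z.snd = 0 then indicatorFun (Iic 0) z.fst
    else ⊤ := by
  simp only [perspective, recession_expFun, expFun, smul_eq_mul, EReal.coe_mul,
    inv_mul_eq_div]

theorem perspective_expFun_of_pos (y : ℝ) {τ : ℝ} (hτ : 0 < τ) :
    perspective expFun (pair y τ) = ((τ * Real.exp (y / τ) : ℝ) : EReal) := by
  simp [perspective_expFun, hτ]

theorem perspective_expFun_zero {y : ℝ} (hy : y ≤ 0) : perspective expFun (pair y 0) = 0 := by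
  simp [perspective_expFun, indicatorFun, hy]

theorem perspective_expFun_zero_of_pos {y : ℝ} (hy : 0 < y) :
    perspective expFun (pair y 0) = ⊤ := by
  simp [perspective_expFun, indicatorFun, hy]

theorem perspective_expFun_nonneg (z : HilbertSum ℝ ℝ) : 0 ≤ perspective expFun z := by
  rw [perspective_expFun]
  split_ifs with h1
  · exact EReal.coe_nonneg.2 (by positivity)
  · unfold indicatorFun; split_ifs <;> simp
  · simp

theorem perspective_expFun_le_coe_iff (z : HilbertSum ℝ ℝ) (δ : ℝ) :
    perspective expFun z ≤ (δ : EReal) ↔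
      (0 < z.snd ∧ z.snd * Real.exp (z.fst / z.snd) ≤ δ) ∨
        (z.fst ≤ 0 ∧ z.snd = 0 ∧ 0 ≤ δ) := by
  rw [perspective_expFun]
  rcases lt_trichotomy 0 z.snd with h | h | h
  · simp only [h, if_true, EReal.coe_le_coe_iff, true_and, h.ne', false_and, and_false, or_false]
  · simp only [← h, lt_irrefl, if_false, if_true, false_and, false_or, true_and]
    by_cases hx : z.fst ≤ 0 <;> simp [indicatorFun, hx]
  · simp [h.not_gt, h.ne]

theorem mem_dom_perspective_expFun (z : HilbertSum ℝ ℝ) :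
    z ∈ dom (perspective expFun) ↔ 0 < z.snd ∨ (z.fst ≤ 0 ∧ z.snd = 0) := by
  simp only [dom, mem_ofPred_eq, perspective_expFun]
  rcases lt_trichotomy 0 z.snd with h | h | h
  · simp only [h, if_true, true_or, EReal.coe_lt_top]
  · simp only [← h, lt_irrefl, if_false, if_true, false_or, and_true]
    by_cases hx : z.fst ≤ 0 <;> simp [indicatorFun, hx]
  · simp [h.not_gt, h.ne]

theorem epi_perspective_expFun : epi (perspective expFun) = expCone := by
  ext z
  simp only [epi, expCone, mem_ofPred_eq, perspective_expFun_le_coe_iff]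
  constructor
  · exact fun h => ⟨_, _, _, rfl, h⟩
  · rintro ⟨x, η, δ, rfl, h⟩
    exact h

/-- The affine minorants of the perspective of the exponential function. -/
theorem mul_exp_le_perspective_expFun (s : ℝ) (z : HilbertSum ℝ ℝ) :
    ((Real.exp s * (z.fst + (1 - s) * z.snd) : ℝ) : EReal) ≤ perspective expFun z := by
  rw [perspective_expFun]
  split_ifs with h1 h2
  · rw [EReal.coe_le_coe_iff]
    have h := mul_le_mul_of_nonneg_left (exp_subgradient s (z.fst / z.snd)) h1.le
    calc Real.exp s * (z.fst + (1 - s) * z.snd)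
        = z.snd * (Real.exp s * (1 + z.fst / z.snd - s)) := by field_simp; ring
      _ ≤ _ := h
  · by_cases hx : z.fst ≤ 0
    · simpa [indicatorFun, hx, h2] using
        EReal.coe_nonpos.2 (mul_nonpos_of_nonneg_of_nonpos (Real.exp_pos s).le hx)
    · simp [indicatorFun, hx]
  · exact le_top

/-- The linear minorants describe the epigraph completely. For `η > 0` the one with `s = x/η` is
tight. For `η = 0`, letting `s → +∞` excludes `x > 0`, and `s → -∞` gives `δ ≥ 0`. -/
theorem mem_epi_perspective_expFun_iff (z : HilbertSum (HilbertSum ℝ ℝ) ℝ) :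
    z ∈ epi (perspective expFun) ↔
      0 ≤ z.fst.snd ∧ ∀ s : ℝ, Real.exp s * (z.fst.fst + (1 - s) * z.fst.snd) ≤ z.snd := by
  constructor
  · intro hz
    refine ⟨?_, fun s => EReal.coe_le_coe_iff.1 ((mul_exp_le_perspective_expFun s z.fst).trans hz)⟩
    rcases (perspective_expFun_le_coe_iff _ _).1 hz with h | h
    · exact h.1.le
    · exact h.2.1.ge
  · rintro ⟨h0, h⟩
    refine (perspective_expFun_le_coe_iff _ _).2 ?_
    rcases h0.lt_or_eq with h0 | h0
    · refine Or.inl ⟨h0, ?_⟩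
      convert h (z.fst.fst / z.fst.snd) using 1
      field_simp
      ring
    · simp only [← h0, mul_zero, add_zero] at h
      refine Or.inr ⟨?_, h0.symm, ?_⟩
      · by_contra! hx
        have ht := Real.tendsto_exp_atTop.atTop_mul_const hx
        obtain ⟨s, hs⟩ := (ht.eventually_gt_atTop z.snd).exists
        exact (h s).not_gt hs
      · have ht := Real.tendsto_exp_atBot.mul_const z.fst.fst
        rw [zero_mul] at ht
        exact le_of_tendsto ht (Eventually.of_forall h)

theorem isClosed_epi_perspective_expFun : IsClosed (epi (perspective expFun)) := by
  have : epi (perspective expFun) = {z | 0 ≤ z.fst.snd} ∩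
      ⋂ s : ℝ, {z | Real.exp s * (z.fst.fst + (1 - s) * z.fst.snd) ≤ z.snd} := by
    ext z; simp [mem_epi_perspective_expFun_iff]
  rw [this]
  refine (isClosed_le (by fun_prop) (by fun_prop)).inter (isClosed_iInter fun s =>
    isClosed_le (by fun_prop) (by fun_prop))

theorem convex_epi_perspective_expFun : Convex ℝ (epi (perspective expFun)) := by
  intro u hu v hv a b ha hb _
  rw [mem_epi_perspective_expFun_iff] at hu hv ⊢
  simp only [WithLp.add_fst, WithLp.add_snd, WithLp.smul_fst, WithLp.smul_snd, smul_eq_mul]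
  refine ⟨by nlinarith [hu.1, hv.1, mul_nonneg ha hu.1, mul_nonneg hb hv.1], fun s => ?_⟩
  nlinarith [mul_le_mul_of_nonneg_left (hu.2 s) ha, mul_le_mul_of_nonneg_left (hv.2 s) hb]

theorem closure_dom_perspective_expFun :
    closure (dom (perspective expFun)) = {z | 0 ≤ z.snd} := by
  refine subset_antisymm (closure_minimal (fun z hz => ?_) (isClosed_le (by fun_prop)
    (by fun_prop))) fun z hz => ?_
  · rcases (mem_dom_perspective_expFun z).1 hz with h | h
    · exact h.le
    · exact h.2.ge
  · have ht : Tendsto (fun ε : ℝ => z + ε • pair 0 1) (𝓝[>] 0) (𝓝 z) := by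
      have : Continuous fun ε : ℝ => z + ε • (pair 0 1 : HilbertSum ℝ ℝ) := by fun_prop
      simpa using (this.tendsto 0).mono_left nhdsWithin_le_nhds
    refine mem_closure_of_tendsto ht ?_
    filter_upwards [self_mem_nhdsWithin] with ε hε
    refine (mem_dom_perspective_expFun _).2 (Or.inl ?_)
    simpa using add_pos_of_nonneg_of_pos hz hε

theorem isProx_closure_dom_perspective_expFun (x η : ℝ) :
    IsProx (indicatorFun (closure (dom (perspective expFun)))) (pair x η)
      (pair x (max 0 η)) := by
  rw [closure_dom_perspective_expFun]
  refine isProx_indicatorFun_of_inner_nonpos (by simp) fun z hz => ?_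
  simp only [mem_ofPred_eq] at hz
  simp only [WithLp.prod_inner_apply]
  simp
  rcases le_total η 0 with h | h
  · simpa [h] using mul_nonpos_of_nonneg_of_nonpos hz h
  · simp [h]

/-! ### Lambert W, the conjugate, and the one-variable proximity operators. -/

theorem neg_exp_neg_one_le {y : ℝ} (hy : 0 < y) : -Real.exp (-1) ≤ y := by
  linarith [Real.exp_pos (-1)]

theorem lambertW_pos {y : ℝ} (hy : 0 < y) : 0 < lambertW y := by
  have h := (lambertW_spec (neg_exp_neg_one_le hy)).2
  exact pos_of_mul_pos_left (h ▸ hy) (Real.exp_pos _).le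

/-- The defining equation of `W` as a fixed point; with `a = γ` and `b = x` it is the optimality
condition `x - p = γ e^p` for `p = x - W`. -/
theorem lambertW_eq_mul_exp {a b : ℝ} (ha : 0 < a) :
    lambertW (a * Real.exp b) = a * Real.exp (b - lambertW (a * Real.exp b)) := by
  have h := (lambertW_spec (neg_exp_neg_one_le (mul_pos ha (Real.exp_pos b)))).2
  rw [Real.exp_sub, mul_div_assoc', eq_div_iff (Real.exp_pos _).ne', h]

theorem isProx_scaled_expFun {γ : ℝ} (hγ : 0 < γ) (x : ℝ) :
    IsProx (scaled γ expFun) x (x - lambertW (γ * Real.exp x)) := by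
  refine isProx_of_subgradient (c := lambertW (γ * Real.exp x)) ?_ fun z => ?_
  · simp only [scaled, expFun]
    rw [← EReal.coe_mul, ← lambertW_eq_mul_exp hγ]
  · simp only [scaled, expFun]
    rw [← EReal.coe_mul, EReal.coe_le_coe_iff]
    have hW := lambertW_eq_mul_exp (b := x) hγ
    set W := lambertW (γ * Real.exp x)
    have h := mul_le_mul_of_nonneg_left (exp_subgradient (x - W) z) hγ.le
    simp only [sub_sub_cancel, RCLike.inner_apply, conj_trivial]
    calc W + (z - (x - W)) * W = W * (1 + z - (x - W)) := by ring
      _ = γ * (Real.exp (x - W) * (1 + z - (x - W))) := by rw [← mul_assoc, ← hW]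
      _ ≤ _ := h

theorem expFun_prox {γ : ℝ} (hγ : 0 < γ) (x : ℝ) :
    expFun (x - lambertW (γ * Real.exp x)) = ((1 / γ * lambertW (γ * Real.exp x) : ℝ) : EReal) := by
  rw [expFun, EReal.coe_eq_coe_iff, one_div, eq_inv_mul_iff_mul_eq₀ hγ.ne',
    ← lambertW_eq_mul_exp hγ]

theorem le_conjugate_expFun (s ξ : ℝ) :
    ((s * ξ - Real.exp s : ℝ) : EReal) ≤ conjugate expFun ξ := by
  refine le_iSup_of_le s ?_
  simp [expFun, mul_comm]

/-- The supremum is attained at `s = log ξ` when `ξ > 0`, and approached as `s → -∞` otherwise. -/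
theorem conjugate_expFun (ξ : ℝ) : conjugate expFun ξ =
    if 0 < ξ then ((ξ * (Real.log ξ - 1) : ℝ) : EReal)
    else if ξ = 0 then 0
    else ⊤ := by
  have hle : ∀ c : ℝ, (∀ s : ℝ, s * ξ - Real.exp s ≤ c) → conjugate expFun ξ ≤ (c : EReal) := by
    refine fun c h => iSup_le fun s => ?_
    have := EReal.coe_le_coe_iff.2 (h s)
    simpa [expFun, mul_comm] using this
  split_ifs with h1 h2
  · refine le_antisymm (hle _ fun s => ?_) ?_
    · have h := exp_subgradient (Real.log ξ) s
      rw [Real.exp_log h1] at h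
      linarith
    · have h := le_conjugate_expFun (Real.log ξ) ξ
      rw [Real.exp_log h1] at h
      convert h using 2
      ring
  · subst h2
    refine le_antisymm (hle 0 fun s => by simpa using (Real.exp_pos s).le) ?_
    have ht : Tendsto (fun s : ℝ => ((s * 0 - Real.exp s : ℝ) : EReal)) atBot (𝓝 0) := by
      refine (continuous_coe_real_ereal.tendsto 0).comp ?_
      simpa using Real.tendsto_exp_atBot.neg
    exact le_of_tendsto ht (Eventually.of_forall fun s => le_conjugate_expFun s 0)
  · have hξ : ξ < 0 := lt_of_le_of_ne (not_lt.1 h1) h2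
    have ht : Tendsto (fun s : ℝ => ((s * ξ - Real.exp s : ℝ) : EReal)) atBot (𝓝 ⊤) := by
      refine EReal.tendsto_coe_nhds_top_iff.2 ?_
      simp only [sub_eq_add_neg]
      exact (tendsto_id.atBot_mul_const_of_neg hξ).atTop_add Real.tendsto_exp_atBot.neg
    exact top_le_iff.1 (le_of_tendsto ht (Eventually.of_forall fun s => le_conjugate_expFun s ξ))

theorem conjugate_expFun_of_pos {ξ : ℝ} (h : 0 < ξ) :
    conjugate expFun ξ = ((ξ * (Real.log ξ - 1) : ℝ) : EReal) := by
  simp [conjugate_expFun, h]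

theorem closure_dom_conjugate_expFun : closure (dom (conjugate expFun)) = Ici 0 := by
  have : dom (conjugate expFun) = Ici 0 := by
    ext ξ
    simp only [dom, mem_ofPred_eq, conjugate_expFun, mem_Ici]
    rcases lt_trichotomy 0 ξ with h | h | h
    · simp only [h, if_true, EReal.coe_lt_top, h.le]
    · simp [← h]
    · simp [h.not_gt, h.ne, h.not_ge]
  rw [this, closure_Ici]

theorem isProx_closure_dom_conjugate_expFun (ξ : ℝ) :
    IsProx (indicatorFun (closure (dom (conjugate expFun)))) ξ (max 0 ξ) := by
  rw [closure_dom_conjugate_expFun]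
  refine isProx_indicatorFun_of_inner_nonpos (by simp) fun z hz => ?_
  simp only [RCLike.inner_apply, conj_trivial]
  rcases le_total ξ 0 with h | h
  · simpa [h] using mul_nonpos_of_nonneg_of_nonpos hz h
  · simp [h]

theorem add_mul_log_nonpos_iff {x μ : ℝ} (hx : 0 < x) (hμ : 0 < μ) (η : ℝ) :
    η + x * (Real.log (x / μ) - 1) ≤ 0 ↔ x * Real.exp (η / x - 1) ≤ μ := by
  rw [← Real.log_le_log_iff (mul_pos hx (Real.exp_pos _)) hμ,
    Real.log_mul hx.ne' (Real.exp_pos _).ne', Real.log_exp, Real.log_div hx.ne' hμ.ne',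
    ← mul_le_mul_iff_right₀ (b := Real.log x + (η / x - 1)) hx]
  have : x * (Real.log x + (η / x - 1)) = x * Real.log x + η - x := by field_simp; ring
  rw [this]
  constructor <;> intro h <;> linarith

theorem add_mul_conjugate_expFun_nonpos_iff (x η : ℝ) {μ : ℝ} (hμ : 0 < μ) :
    (η : EReal) + (μ : EReal) * conjugate expFun (max 0 (x / μ)) ≤ 0 ↔
      (x ≤ 0 ∧ η ≤ 0) ∨ (0 < x ∧ x * Real.exp (η / x - 1) ≤ μ) := by
  rcases le_or_gt x 0 with hx | hx
  · have : max 0 (x / μ) = 0 := max_eq_left (div_nonpos_of_nonpos_of_nonneg hx hμ.le)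
    simp [this, conjugate_expFun, hx, hx.not_gt]
  · have hxμ := div_pos hx hμ
    rw [max_eq_right hxμ.le, conjugate_expFun_of_pos hxμ, ← EReal.coe_mul, ← EReal.coe_add,
      EReal.coe_nonpos, ← add_mul_log_nonpos_iff hx hμ, ← mul_assoc, mul_div_cancel₀ x hμ.ne']
    simp [hx, hx.not_ge]

theorem log_mul_lambertW {γ : ℝ} (hγ : 0 < γ) (x : ℝ) :
    Real.log (γ * lambertW (Real.exp (x / γ) / γ)) =
      x / γ - lambertW (Real.exp (x / γ) / γ) := by
  have h := lambertW_eq_mul_exp (b := x / γ) (inv_pos.2 hγ)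
  rw [inv_mul_eq_div, inv_mul_eq_div, eq_div_iff hγ.ne', mul_comm] at h
  rw [h, Real.log_exp]

theorem conjugate_expFun_prox {γ : ℝ} (hγ : 0 < γ) (x : ℝ) :
    conjugate expFun (γ * lambertW (Real.exp (x / γ) / γ)) =
      (((x - γ) * lambertW (Real.exp (x / γ) / γ)
          - γ * lambertW (Real.exp (x / γ) / γ) ^ 2 : ℝ) : EReal) := by
  rw [conjugate_expFun_of_pos (mul_pos hγ (lambertW_pos (by positivity))),
    log_mul_lambertW hγ]
  congr 1
  field_simp
  ring

theorem isProx_scaled_conjugate_expFun {γ : ℝ} (hγ : 0 < γ) (x : ℝ) :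
    IsProx (scaled γ (conjugate expFun)) x (γ * lambertW (Real.exp (x / γ) / γ)) := by
  have hlog := log_mul_lambertW hγ x
  have hval := conjugate_expFun_prox hγ x
  have hpos : 0 < γ * lambertW (Real.exp (x / γ) / γ) :=
    mul_pos hγ (lambertW_pos (by positivity))
  set W := lambertW (Real.exp (x / γ) / γ)
  refine isProx_of_subgradient (c := γ * ((x - γ) * W - γ * W ^ 2)) ?_ fun z => ?_
  · rw [scaled, hval, ← EReal.coe_mul]
  -- The Fenchel–Young inequality at slope `log p`, where `p = γW`, is the required subgradient
  -- inequality because `x - p = γ log p`.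
  · have h := mul_le_mul_of_nonneg_left (le_conjugate_expFun (Real.log (γ * W)) z)
      (EReal.coe_nonneg.2 hγ.le)
    refine le_trans (le_of_eq ?_) h
    rw [Real.exp_log hpos, hlog, ← EReal.coe_mul]
    congr 1
    simp only [RCLike.inner_apply, conj_trivial]
    field_simp
    ring

/-! ### The proximity operator of the perspective. -/

/-- A homogeneous form of the subgradient characterization of the proximity operator. -/
theorem isProx_scaled_of_inner_le {E : Type*} [NormedAddCommGroup E] [InnerProductSpace ℝ E]
    {g : E → EReal} {μ c : ℝ} {w p : E} (hp : g p = (c : EReal))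
    (hc : μ * c = inner ℝ (w - p) p)
    (h : ∀ z, ((inner ℝ (w - p) z : ℝ) : EReal) ≤ (μ : EReal) * g z) :
    IsProx (scaled μ g) w p := by
  refine isProx_of_subgradient (c := μ * c) (by rw [scaled, hp, EReal.coe_mul]) fun z => ?_
  rw [inner_sub_right, hc, add_sub_cancel]
  exact h z

theorem inner_pair (a b : ℝ) (z : HilbertSum ℝ ℝ) :
    inner ℝ (pair a b) z = a * z.fst + b * z.snd := by
  simp [WithLp.prod_inner_apply, mul_comm]

theorem pair_sub_pair {E F : Type*} [AddCommGroup E] [AddCommGroup F] (a c : E) (b d : F) :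
    pair a b - pair c d = pair (a - c) (b - d) := rfl

/-- An inequality on `b` suffices because `z.snd ≥ 0` on the domain. The slack is what the prox at
the origin needs; for `ν > 0` equality holds. -/
theorem inner_le_mul_perspective_expFun {μ : ℝ} (hμ : 0 < μ) {a b s : ℝ}
    (ha : a = μ * Real.exp s) (hb : b ≤ μ * Real.exp s * (1 - s)) (z : HilbertSum ℝ ℝ) :
    ((inner ℝ (pair a b) z : ℝ) : EReal) ≤ (μ : EReal) * perspective expFun z := by
  by_cases hz : z ∈ dom (perspective expFun)
  · have hz0 : 0 ≤ z.snd := by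
      rcases (mem_dom_perspective_expFun z).1 hz with h | h
      exacts [h.le, h.2.ge]
    refine le_trans ?_ (mul_le_mul_of_nonneg_left (mul_exp_le_perspective_expFun s z)
      (EReal.coe_nonneg.2 hμ.le))
    rw [← EReal.coe_mul, EReal.coe_le_coe_iff, inner_pair, ha]
    nlinarith [mul_le_mul_of_nonneg_right hb hz0]
  · have : perspective expFun z = ⊤ := not_lt_top_iff.1 hz
    rw [this, EReal.coe_mul_top_of_pos hμ]
    exact le_top

theorem isProx_perspective_expFun_zero {x η μ : ℝ} (hμ : 0 < μ) (hx : 0 < x)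
    (h : x * Real.exp (η / x - 1) ≤ μ) :
    IsProx (scaled μ (perspective expFun)) (pair x η) (pair 0 0) := by
  refine isProx_scaled_of_inner_le (c := 0) (by simp [perspective_expFun_zero]) ?_ fun z => ?_
  · rw [pair_sub_pair, inner_pair]; simp
  · rw [pair_sub_pair, sub_zero, sub_zero]
    have he : x = μ * Real.exp (Real.log (x / μ)) := by
      rw [Real.exp_log (div_pos hx hμ), mul_div_cancel₀ x hμ.ne']
    refine inner_le_mul_perspective_expFun hμ he ?_ z
    rw [← he]
    linarith [(add_mul_log_nonpos_iff hx hμ η).2 h]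

theorem isProx_perspective_expFun_boundary {x η μ : ℝ} (hμ : 0 < μ) (hx : x ≤ 0) (hη : η ≤ 0) :
    IsProx (scaled μ (perspective expFun)) (pair x η) (pair x 0) := by
  refine isProx_scaled_of_inner_le (c := 0) (by simp [perspective_expFun_zero hx]) ?_ fun z => ?_
  · rw [pair_sub_pair, inner_pair]; simp
  · rw [pair_sub_pair, inner_pair, sub_self, zero_mul, zero_add, sub_zero]
    by_cases hz : z ∈ dom (perspective expFun)
    · have hz0 : 0 ≤ z.snd := by
        rcases (mem_dom_perspective_expFun z).1 hz with h | h
        exacts [h.le, h.2.ge]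
      exact (EReal.coe_nonpos.2 (mul_nonpos_of_nonpos_of_nonneg hη hz0)).trans
        (mul_nonneg (EReal.coe_nonneg.2 hμ.le) (perspective_expFun_nonneg z))
    · have : perspective expFun z = ⊤ := not_lt_top_iff.1 hz
      rw [this, EReal.coe_mul_top_of_pos hμ]
      exact le_top

theorem isProx_perspective_expFun_interior {x η μ ν s : ℝ} (hμ : 0 < μ) (hν : 0 < ν)
    (hx : x = ν * s + μ * Real.exp s) (hη : η = ν + μ * Real.exp s * (1 - s)) :
    IsProx (scaled μ (perspective expFun)) (pair x η) (pair (ν * s) ν) := by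
  refine isProx_scaled_of_inner_le (perspective_expFun_of_pos _ hν) ?_ fun z => ?_
  · rw [pair_sub_pair, inner_pair, mul_div_cancel_left₀ s hν.ne', hx, hη]
    simp only [WithLp.toLp_fst, WithLp.toLp_snd]
    ring
  · rw [pair_sub_pair]
    exact inner_le_mul_perspective_expFun hμ (by rw [hx]; ring) (by rw [hη]; linarith) z

theorem lambertW_eq_of_slope {x μ ν s : ℝ} (hμ : 0 < μ) (hν : 0 < ν)
    (hx : x = ν * s + μ * Real.exp s) :
    lambertW (μ / ν * Real.exp (x / ν)) = μ / ν * Real.exp s := by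
  have : μ / ν * Real.exp (x / ν) = μ / ν * Real.exp s * Real.exp (μ / ν * Real.exp s) := by
    rw [mul_assoc, ← Real.exp_add, hx]
    congr 2
    field_simp
  rw [this, lambertW_mul_exp]
  have : 0 < μ / ν * Real.exp s := by positivity
  linarith

/-- The optimality system of the proximity operator of the perspective, in terms of the
logarithmic slope `s`, is equivalent to the scalar equation involving the Lambert W-function. -/
theorem exists_slope_iff {x η μ ν : ℝ} (hμ : 0 < μ) (hν : 0 < ν) :
    (∃ s, x = ν * s + μ * Real.exp s ∧ η = ν + μ * Real.exp s * (1 - s)) ↔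
      ν = η + (x - ν) * lambertW (μ / ν * Real.exp (x / ν))
            - ν * lambertW (μ / ν * Real.exp (x / ν)) ^ 2 := by
  constructor
  · rintro ⟨s, hx, hη⟩
    have hW := lambertW_eq_of_slope hμ hν hx
    rw [hW, hη, hx]
    field_simp
    ring
  · intro h
    have hW := lambertW_eq_mul_exp (b := x / ν) (div_pos hμ hν)
    set W := lambertW (μ / ν * Real.exp (x / ν))
    have hW' : μ * Real.exp (x / ν - W) = ν * W := by
      conv_rhs => rw [hW]
      field_simp
    refine ⟨x / ν - W, ?_, ?_⟩
    · rw [hW']; field_simp; ring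
    · rw [hW']
      have : ν * W * (1 - (x / ν - W)) = ν * W - x * W + ν * W ^ 2 := by field_simp; ring
      rw [this]; linarith

/-- With `u = -s ≥ 0`, `1 + u + u² ≤ 2 (1 + u + u²/2) ≤ 2 e^u`. -/
theorem exp_mul_quadratic_le {s : ℝ} (hs : s ≤ 0) : Real.exp s * (1 - s + s ^ 2) ≤ 2 := by
  have h := Real.quadratic_le_exp_of_nonneg (neg_nonneg.2 hs)
  have h2 : Real.exp s * Real.exp (-s) = 1 := by rw [← Real.exp_add, add_neg_cancel, Real.exp_zero]
  nlinarith [mul_le_mul_of_nonneg_left h (Real.exp_pos s).le, Real.exp_pos s]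

theorem exists_slope {x η μ : ℝ} (hμ : 0 < μ) (h1 : ¬ (0 < x ∧ x * Real.exp (η / x - 1) ≤ μ))
    (h2 : ¬ (x ≤ 0 ∧ η ≤ 0)) :
    ∃ ν s : ℝ, 0 < ν ∧ x = ν * s + μ * Real.exp s ∧ η = ν + μ * Real.exp s * (1 - s) := by
  -- The second equation gives `ν = η + μ e^s (s - 1)`; substituted into the first, it leaves an
  -- equation in `s` alone.
  suffices H : ∃ s : ℝ, x - s * η - μ * Real.exp s * (1 - s + s ^ 2) = 0 ∧
      0 < η + μ * Real.exp s * (s - 1) by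
    obtain ⟨s, hs, hν⟩ := H
    exact ⟨_, s, hν, by linear_combination hs, by ring⟩
  have hcont : Continuous fun s : ℝ => x - s * η - μ * Real.exp s * (1 - s + s ^ 2) := by
    fun_prop
  -- At a root `νs = x - μ e^s`, so `ν > 0` once `s` and `x - μ e^s` are nonzero of the same sign.
  have hpos_of : ∀ s : ℝ, x - s * η - μ * Real.exp s * (1 - s + s ^ 2) = 0 →
      0 < s * (x - μ * Real.exp s) → 0 < η + μ * Real.exp s * (s - 1) := by
    intro s hs hsx
    have he : s * (x - μ * Real.exp s) = s ^ 2 * (η + μ * Real.exp s * (s - 1)) := by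
      linear_combination s * hs
    exact pos_of_mul_pos_right (he ▸ hsx) (sq_nonneg s)
  rcases le_or_gt x 0 with hx | hx
  · have hη : 0 < η := by
      by_contra! h
      exact h2 ⟨hx, h⟩
    -- Chosen so that `x - tη = 2μ`, which dominates `μ e^t (1 - t + t²)` by `exp_mul_quadratic_le`.
    set t := (x - 2 * μ) / η with ht
    have ht0 : t ≤ 0 := div_nonpos_of_nonpos_of_nonneg (by linarith) hη.le
    have htη : t * η = x - 2 * μ := div_mul_cancel₀ _ hη.ne'
    have hmem : (0 : ℝ) ∈ Icc (x - 0 * η - μ * Real.exp 0 * (1 - 0 + 0 ^ 2))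
        (x - t * η - μ * Real.exp t * (1 - t + t ^ 2)) := by
      constructor
      · simp; linarith
      · nlinarith [mul_le_mul_of_nonneg_left (exp_mul_quadratic_le ht0) hμ.le]
    obtain ⟨s, hs, hs0⟩ := intermediate_value_Icc' ht0 hcont.continuousOn hmem
    refine ⟨s, hs0, hpos_of s hs0 ?_⟩
    refine mul_pos_of_neg_of_neg (lt_of_le_of_ne hs.2 ?_) (by nlinarith [Real.exp_pos s])
    rintro rfl
    simp at hs0
    linarith
  · have hF : 0 < η + x * (Real.log (x / μ) - 1) := by
      by_contra! h
      exact h1 ⟨hx, (add_mul_log_nonpos_iff hx hμ η).1 h⟩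
    -- The zero of `x - μ e^s`. Strictly between `0` and `t`, `s` and `x - μ e^s` have the same
    -- sign, and `hF` gives the function opposite signs at these endpoints when `t ≠ 0`.
    set t := Real.log (x / μ) with ht
    have hexp : μ * Real.exp t = x := by
      rw [ht, Real.exp_log (div_pos hx hμ), mul_div_cancel₀ x hμ.ne']
    have hΦt : x - t * η - μ * Real.exp t * (1 - t + t ^ 2) = -(t * (η + x * (t - 1))) := by
      rw [hexp]; ring
    have hΦ0 : x - 0 * η - μ * Real.exp 0 * (1 - 0 + 0 ^ 2) = μ * Real.exp t - μ := by
      rw [hexp]; simp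
    rcases lt_trichotomy t 0 with ht0 | ht0 | ht0
    · have he := Real.exp_lt_one_iff.2 ht0
      obtain ⟨s, hs, hs0⟩ := intermediate_value_Icc' ht0.le hcont.continuousOn
        (show (0 : ℝ) ∈ Icc _ _ from
          ⟨by rw [hΦ0]; nlinarith, by rw [hΦt]; nlinarith⟩)
      refine ⟨s, hs0, hpos_of s hs0 ?_⟩
      refine mul_pos_of_neg_of_neg (lt_of_le_of_ne hs.2 ?_) ?_
      · rintro rfl
        simp only at hs0
        rw [hΦ0] at hs0
        nlinarith
      · rw [← hexp, sub_neg]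
        refine mul_lt_mul_of_pos_left (Real.exp_lt_exp.2 (lt_of_le_of_ne hs.1 ?_)) hμ
        rintro rfl
        simp only at hs0
        rw [hΦt] at hs0
        nlinarith
    · rw [ht0] at hF hexp
      refine ⟨0, by rw [hΦ0, ht0]; simp, ?_⟩
      rw [hexp]; exact hF
    · have he := Real.one_lt_exp_iff.2 ht0
      obtain ⟨s, hs, hs0⟩ := intermediate_value_Icc' ht0.le hcont.continuousOn
        (show (0 : ℝ) ∈ Icc _ _ from
          ⟨by rw [hΦt]; nlinarith [mul_pos ht0 hF], by rw [hΦ0]; nlinarith⟩)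
      refine ⟨s, hs0, hpos_of s hs0 ?_⟩
      refine mul_pos (lt_of_le_of_ne hs.1 ?_) ?_
      · rintro rfl
        simp only at hs0
        rw [hΦ0] at hs0
        nlinarith
      · rw [← hexp, sub_pos]
        refine mul_lt_mul_of_pos_left (Real.exp_lt_exp.2 (lt_of_le_of_ne hs.2 ?_)) hμ
        rintro rfl
        simp only at hs0
        rw [hΦt] at hs0
        nlinarith [mul_pos ht0 hF]

/-- The tangent to `μ exp` at `log (x/μ)`, which has slope `x`, shows that the right side exceeds
`ν` by at least `νs²`. -/
theorem slope_bound_of_pos {x η μ ν s : ℝ} (hμ : 0 < μ) (hν : 0 < ν) (hx0 : 0 < x)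
    (hx : x = ν * s + μ * Real.exp s) (hη : η = ν + μ * Real.exp s * (1 - s)) :
    ν ≤ η + x * (Real.log (x / μ) - 1) := by
  have h := exp_subgradient (Real.log (x / μ)) s
  rw [Real.exp_log (div_pos hx0 hμ)] at h
  have h' := mul_le_mul_of_nonneg_left h hμ.le
  rw [← mul_assoc, mul_div_cancel₀ x hμ.ne'] at h'
  have hxs : x * s = ν * s ^ 2 + μ * Real.exp s * s := by linear_combination s * hx
  linarith [mul_nonneg hν.le (sq_nonneg s)]

theorem slope_bound_of_nonpos {x η μ ν s : ℝ} (hμ : 0 < μ) (hν : 0 < ν) (hx0 : x ≤ 0)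
    (hx : x = ν * s + μ * Real.exp s) (hη : η = ν + μ * Real.exp s * (1 - s)) : ν ≤ η := by
  have he := mul_pos hμ (Real.exp_pos s)
  have hs : s < 0 := by
    by_contra! hs
    nlinarith [mul_nonneg hν.le hs]
  nlinarith

theorem exists_isProx_perspective_expFun {x η μ : ℝ} (hμ : 0 < μ) :
    ∃ p, IsProx (scaled μ (perspective expFun)) (pair x η) p := by
  by_cases h1 : 0 < x ∧ x * Real.exp (η / x - 1) ≤ μ
  · exact ⟨_, isProx_perspective_expFun_zero hμ h1.1 h1.2⟩
  by_cases h2 : x ≤ 0 ∧ η ≤ 0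
  · exact ⟨_, isProx_perspective_expFun_boundary hμ h2.1 h2.2⟩
  obtain ⟨ν, s, hν, hx, hη⟩ := exists_slope hμ h1 h2
  exact ⟨_, isProx_perspective_expFun_interior hμ hν hx hη⟩

/-! ### The projection onto the epigraph. -/

theorem inner_pair_pair {E F : Type*} [NormedAddCommGroup E] [InnerProductSpace ℝ E]
    [NormedAddCommGroup F] [InnerProductSpace ℝ F] (a : E) (b : F) (z : HilbertSum E F) :
    inner ℝ (pair a b) z = inner ℝ a z.fst + inner ℝ b z.snd := rfl

theorem exists_normal_mem_epi (w : HilbertSum (HilbertSum ℝ ℝ) ℝ) :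
    ∃ p ∈ epi (perspective expFun), ∀ z ∈ epi (perspective expFun),
      inner ℝ (w - p) (z - p) ≤ 0 := by
  have hne : (epi (perspective expFun)).Nonempty :=
    ⟨pair (pair 0 0) 0, by simp [epi, perspective_expFun_zero]⟩
  obtain ⟨p, hp, h⟩ := exists_norm_eq_iInf_of_complete_convex hne
    isClosed_epi_perspective_expFun.isComplete convex_epi_perspective_expFun w
  exact ⟨p, hp, (norm_eq_iInf_iff_real_inner_le_zero convex_epi_perspective_expFun hp).1 h⟩

/-- Serves for the upper bound on `μ`, with `q` the projection onto the closed domain: a point at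
least as close to `x` as the prox cannot have a smaller value. -/
theorem IsProx.value_le {E : Type*} [NormedAddCommGroup E] {g : E → EReal} {μ a b : ℝ}
    (hμ : 0 < μ) {x p q : E} (h : IsProx (scaled μ g) x p) (hp : g p = (a : EReal))
    (hq : g q = (b : EReal)) (hn : ‖x - q‖ ≤ ‖x - p‖) : a ≤ b := by
  by_cases hqp : q = p
  · rw [hqp, hp, EReal.coe_eq_coe_iff] at hq
    exact hq.le
  · have h1 := h q hqp
    simp only [scaled, hp, hq, ← EReal.coe_mul, ← EReal.coe_add, EReal.coe_lt_coe_iff] at h1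
    have h2 : ‖x - q‖ ^ 2 ≤ ‖x - p‖ ^ 2 := by gcongr
    exact (lt_of_mul_lt_mul_left (by linarith) hμ.le).le

/-- Combine minimality of `q` with `(ρ - δ)² ≥ μ² + 2μ (ρ - δ - μ)` and `ρ ≥ g y`. Convexity of `g`
plays no role. -/
theorem isProx_epi_of_isProx_scaled {E : Type*} [NormedAddCommGroup E] [InnerProductSpace ℝ E]
    {g : E → EReal} {δ μ : ℝ} (hμ : 0 < μ) {x q : E} (hg : ∀ z, g z ≠ ⊥)
    (hq : g q = ((δ + μ : ℝ) : EReal)) (h : IsProx (scaled μ g) x q) :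
    IsProx (indicatorFun (epi g)) (pair x δ) (pair q (δ + μ)) := by
  refine (isProx_indicatorFun_iff ⟨pair q (δ + μ), hq.le⟩).2 ⟨hq.le, fun z hz hne => ?_⟩
  obtain ⟨y, ρ, rfl⟩ : ∃ y ρ, z = pair y ρ := ⟨z.fst, z.snd, rfl⟩
  have hz : g y ≤ (ρ : EReal) := hz
  rw [← sq_lt_sq₀ (norm_nonneg _) (norm_nonneg _), WithLp.prod_norm_sq_eq_of_L2,
    WithLp.prod_norm_sq_eq_of_L2]
  simp only [pair_sub_pair, WithLp.toLp_fst, WithLp.toLp_snd, Real.norm_eq_abs, sq_abs]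
  obtain ⟨c, hc⟩ : ∃ c : ℝ, g y = (c : EReal) :=
    ⟨_, (EReal.coe_toReal (hz.trans_lt (EReal.coe_lt_top _)).ne (hg y)).symm⟩
  rw [hc, EReal.coe_le_coe_iff] at hz
  by_cases hyq : y = q
  · subst hyq
    rw [hc, EReal.coe_eq_coe_iff] at hq
    have : δ + μ < ρ := lt_of_le_of_ne (hq ▸ hz) fun e => hne (by rw [e])
    nlinarith
  · have h1 := h y hyq
    simp only [scaled, hc, hq, ← EReal.coe_mul, ← EReal.coe_add, EReal.coe_lt_coe_iff] at h1
    nlinarith [sq_nonneg (ρ - δ - μ), mul_le_mul_of_nonneg_left hz hμ.le]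

theorem isProx_epi_perspective_boundary {x η δ : ℝ} (hη : η ≤ 0) (hx : x ≤ 0) (hδ : 0 ≤ δ) :
    IsProx (indicatorFun (epi (perspective expFun))) (pair (pair x η) δ)
      (pair (pair x 0) δ) := by
  refine isProx_indicatorFun_of_inner_nonpos ?_ fun z hz => ?_
  · simpa [epi, perspective_expFun_zero hx] using hδ
  · have h0 := ((mem_epi_perspective_expFun_iff z).1 hz).1
    rw [pair_sub_pair, pair_sub_pair, inner_pair_pair, inner_pair]
    simpa using mul_nonpos_of_nonpos_of_nonneg hη h0

theorem isProx_indicatorFun_self {E : Type*} [NormedAddCommGroup E] [InnerProductSpace ℝ E]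
    {C : Set E} {w : E} (hw : w ∈ C) : IsProx (indicatorFun C) w w :=
  isProx_indicatorFun_of_inner_nonpos hw fun z _ => by simp

theorem exists_isProx_scaled_epi {x η δ : ℝ} (h1 : ¬ (η ≤ 0 ∧ x ≤ 0 ∧ 0 ≤ δ))
    (h2 : ¬ (0 < η ∧ η * Real.exp (x / η) ≤ δ)) :
    ∃ (μ : ℝ) (q : HilbertSum ℝ ℝ), 0 < μ ∧
      IsProx (scaled μ (perspective expFun)) (pair x η) q ∧
      perspective expFun q = ((δ + μ : ℝ) : EReal) ∧
      IsProx (indicatorFun (epi (perspective expFun))) (pair (pair x η) δ)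
        (pair q (δ + μ)) := by
  obtain ⟨p, hp, h⟩ := exists_normal_mem_epi (pair (pair x η) δ)
  obtain ⟨q, ρ, rfl⟩ : ∃ q ρ, p = pair q ρ := ⟨p.fst, p.snd, rfl⟩
  have h' : ∀ (z : HilbertSum ℝ ℝ) (r : ℝ), perspective expFun z ≤ (r : EReal) →
      inner ℝ (pair x η - q) (z - q) + (r - ρ) * (δ - ρ) ≤ 0 := fun z r hz => h (pair z r) hz
  have hqρ : perspective expFun q ≤ (ρ : EReal) := hp
  have hcoe : ∀ z, z ∈ dom (perspective expFun) → ∃ r : ℝ, perspective expFun z = (r : EReal) :=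
    fun z hz => ⟨_, (EReal.coe_toReal hz.ne
      (ne_of_gt (EReal.bot_lt_zero.trans_le (perspective_expFun_nonneg z)))).symm⟩
  obtain ⟨c, hc⟩ := hcoe q (hqρ.trans_lt (EReal.coe_lt_top _))
  -- The epigraph is stable under raising the last coordinate; test the normal inequality at `(q, ρ
  -- + 1)`.
  have hμ0 : δ ≤ ρ := by
    have := h' q (ρ + 1) (hqρ.trans (EReal.coe_le_coe_iff.2 (by linarith)))
    simp at this
    linarith
  have hμ : 0 < ρ - δ := by
    refine sub_pos.2 (lt_of_le_of_ne hμ0 ?_)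
    rintro rfl
    -- If `ρ = δ` the vertical term vanishes, so `q` is the projection onto the closed domain, and
    -- membership in the epigraph falls under one of the two excluded cases.
    have hn : ∀ z ∈ closure (dom (perspective expFun)), inner ℝ (pair x η - q) (z - q) ≤ 0 := by
      refine fun z hz => closure_minimal (t := {z | inner ℝ (pair x η - q) (z - q) ≤ 0}) ?_
        (isClosed_le (by fun_prop) (by fun_prop)) hz
      intro z hz
      obtain ⟨r, hr⟩ := hcoe z hz
      simpa using h' z r hr.le
    have hproj := isProx_indicatorFun_of_inner_nonpos (p := q)
      (subset_closure (s := dom (perspective expFun)) (hqρ.trans_lt (EReal.coe_lt_top _))) hn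
    have hq := hproj.prox_eq.symm.trans (isProx_closure_dom_perspective_expFun x η).prox_eq
    rw [hq, perspective_expFun_le_coe_iff] at hqρ
    simp only [WithLp.toLp_fst, WithLp.toLp_snd] at hqρ
    rcases hqρ with ⟨h3, h4⟩ | ⟨h3, h4, h5⟩
    · have hη : 0 < η := by simpa using h3
      rw [max_eq_right hη.le] at h4
      exact h2 ⟨hη, h4⟩
    · exact h1 ⟨by simpa using h4, h3, h5⟩
  -- Testing at `(q, c)` gives `(c - ρ)(δ - ρ) ≤ 0` with `δ < ρ`: the projection lies on the graph.
  have hcρ : c = ρ := by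
    refine le_antisymm (EReal.coe_le_coe_iff.1 (hc ▸ hqρ)) ?_
    have := h' q c hc.le
    rw [sub_self, inner_zero_right, zero_add] at this
    nlinarith
  subst hcρ
  refine ⟨c - δ, q, hμ, ?_, by rw [hc, add_sub_cancel], ?_⟩
  · refine isProx_of_subgradient (c := (c - δ) * c) (by rw [scaled, hc, EReal.coe_mul])
      fun z => ?_
    by_cases hz : z ∈ dom (perspective expFun)
    · obtain ⟨r, hr⟩ := hcoe z hz
      rw [scaled, hr, ← EReal.coe_mul, EReal.coe_le_coe_iff]
      nlinarith [h' z r hr.le]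
    · have : perspective expFun z = ⊤ := not_lt_top_iff.1 hz
      rw [scaled, this, EReal.coe_mul_top_of_pos hμ]
      exact le_top
  · rw [add_sub_cancel]
    exact isProx_indicatorFun_of_inner_nonpos hp h

theorem perspective_expFun_proj (x η : ℝ) : perspective expFun (pair x (max 0 η)) =
    if 0 < η then ((η * Real.exp (x / η) : ℝ) : EReal) else if x ≤ 0 then 0 else ⊤ := by
  rcases lt_or_ge 0 η with h | h
  · rw [max_eq_right h.le, perspective_expFun_of_pos x h, if_pos h]
  · rw [max_eq_left h, if_neg h.not_gt]
    split_ifs with hx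
    · exact perspective_expFun_zero hx
    · exact perspective_expFun_zero_of_pos (not_le.1 hx)

theorem perspective_expFun_proj_le_iff (x η δ : ℝ) :
    perspective expFun (pair x (max 0 η)) ≤ (δ : EReal) ↔
      (0 < η ∧ η * Real.exp (x / η) ≤ δ) ∨ (η ≤ 0 ∧ x ≤ 0 ∧ 0 ≤ δ) := by
  rw [perspective_expFun_proj]
  rcases lt_or_ge 0 η with h | h
  · simp only [h, if_true, EReal.coe_le_coe_iff, true_and, h.not_ge, false_and, or_false]
  · by_cases hx : x ≤ 0 <;> simp [h, h.not_gt, hx]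

theorem perspective_expFun_prox_le_proj {x η μ δ : ℝ} (hμ : 0 < μ) {q : HilbertSum ℝ ℝ}
    (hq : IsProx (scaled μ (perspective expFun)) (pair x η) q)
    (hval : perspective expFun q = ((δ + μ : ℝ) : EReal)) :
    (μ : EReal) ≤ -(δ : EReal) + perspective expFun (pair x (max 0 η)) := by
  by_cases htop : perspective expFun (pair x (max 0 η)) = ⊤
  · rw [htop, ← EReal.coe_neg, EReal.coe_add_top]
    exact le_top
  obtain ⟨c, hc⟩ : ∃ c : ℝ, perspective expFun (pair x (max 0 η)) = (c : EReal) :=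
    ⟨_, (EReal.coe_toReal htop
      (ne_of_gt (EReal.bot_lt_zero.trans_le (perspective_expFun_nonneg _)))).symm⟩
  have hqD : q ∈ closure (dom (perspective expFun)) :=
    subset_closure (s := dom (perspective expFun)) (hval.trans_lt (EReal.coe_lt_top _))
  have hn : ‖pair x η - pair x (max 0 η)‖ ≤ ‖pair x η - q‖ := by
    by_cases h : q = pair x (max 0 η)
    · rw [h]
    · exact (((isProx_indicatorFun_iff ⟨q, hqD⟩).1
        (isProx_closure_dom_perspective_expFun x η)).2 q hqD h).le
  have h := hq.value_le hμ hval hc hn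
  rw [hc, ← EReal.coe_neg, ← EReal.coe_add, EReal.coe_le_coe_iff]
  linarith

theorem coe_add_coe_sub_eq_zero_iff {a b : ℝ} {y : EReal} :
    (a : EReal) + (b : EReal) - y = 0 ↔ y = ((b + a : ℝ) : EReal) := by
  induction y with
  | bot => simp [← EReal.coe_add]
  | top => simp [← EReal.coe_add]
  | coe y =>
    rw [← EReal.coe_add, ← EReal.coe_sub, EReal.coe_eq_zero, EReal.coe_eq_coe_iff]
    constructor <;> intro h <;> linarith

theorem proj_epi_perspective_expFun {x η δ : ℝ} (h1 : ¬ (η ≤ 0 ∧ x ≤ 0 ∧ 0 ≤ δ))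
    (h2 : ¬ (0 < η ∧ η * Real.exp (x / η) ≤ δ)) :
    ∃ μ : ℝ, 0 < μ ∧
      (μ : EReal) ≤ -(δ : EReal) + perspective expFun (pair x (max 0 η)) ∧
      (μ : EReal) + (δ : EReal) -
        perspective expFun (prox (scaled μ (perspective expFun)) (pair x η)) = 0 ∧
      (∀ μ' : ℝ, 0 < μ' →
        (μ' : EReal) + (δ : EReal) -
          perspective expFun (prox (scaled μ' (perspective expFun)) (pair x η)) = 0 →
        μ' = μ) ∧
      proj (epi (perspective expFun)) (pair (pair x η) δ) =
        pair (prox (scaled μ (perspective expFun)) (pair x η)) (δ + μ) := by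
  obtain ⟨μ, q, hμ, hq, hval, hproj⟩ := exists_isProx_scaled_epi h1 h2
  have hprox := hproj.prox_eq
  refine ⟨μ, hμ, perspective_expFun_prox_le_proj hμ hq hval,
    by rwa [hq.prox_eq, coe_add_coe_sub_eq_zero_iff], fun μ' hμ' h => ?_,
    by rw [hq.prox_eq]; exact hprox⟩
  obtain ⟨q', hq'⟩ := exists_isProx_perspective_expFun (x := x) (η := η) hμ'
  rw [hq'.prox_eq, coe_add_coe_sub_eq_zero_iff] at h
  have hproj' := isProx_epi_of_isProx_scaled hμ' (fun z =>
    ne_of_gt (EReal.bot_lt_zero.trans_le (perspective_expFun_nonneg z))) h hq'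
  have := congrArg WithLp.snd (hproj'.prox_eq.symm.trans hprox)
  simpa using this

theorem exists_isProx_epi_perspective_expFun (w : HilbertSum (HilbertSum ℝ ℝ) ℝ) :
    ∃ p, IsProx (indicatorFun (epi (perspective expFun))) w p := by
  obtain ⟨p, hp, h⟩ := exists_normal_mem_epi w
  exact ⟨p, isProx_indicatorFun_of_inner_nonpos hp h⟩

/-! ### The Lambert W form of the proximity operator, and the final assembly. -/

theorem prox_perspective_expFun_interior {x η μ : ℝ} (hμ : 0 < μ)
    (h1 : ¬ (0 < x ∧ x * Real.exp (η / x - 1) ≤ μ)) (h2 : ¬ (x ≤ 0 ∧ η ≤ 0)) :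
    ∃ ν : ℝ, 0 < ν ∧
      ν = η + (x - ν) * lambertW (μ / ν * Real.exp (x / ν))
        - ν * lambertW (μ / ν * Real.exp (x / ν)) ^ 2 ∧
      (∀ ν' : ℝ, 0 < ν' →
        ν' = η + (x - ν') * lambertW (μ / ν' * Real.exp (x / ν'))
          - ν' * lambertW (μ / ν' * Real.exp (x / ν')) ^ 2 →
        ν' = ν) ∧
      (0 < x → ν ≤ η + x * (Real.log (x / μ) - 1)) ∧
      (x ≤ 0 → ν ≤ η) ∧
      prox (scaled μ (perspective expFun)) (pair x η) =
        pair (x - ν * lambertW (μ / ν * Real.exp (x / ν))) ν ∧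
      perspective expFun (prox (scaled μ (perspective expFun)) (pair x η)) =
        ((ν ^ 2 / μ * lambertW (μ / ν * Real.exp (x / ν)) : ℝ) : EReal) := by
  obtain ⟨ν, s, hν, hx, hη⟩ := exists_slope hμ h1 h2
  have hprox := (isProx_perspective_expFun_interior hμ hν hx hη).prox_eq
  have hW := lambertW_eq_of_slope hμ hν hx
  refine ⟨ν, hν, (exists_slope_iff hμ hν).1 ⟨s, hx, hη⟩, fun ν' hν' h => ?_,
    fun hx0 => slope_bound_of_pos hμ hν hx0 hx hη,
    fun hx0 => slope_bound_of_nonpos hμ hν hx0 hx hη, ?_, ?_⟩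
  -- Any other solution `ν'` also produces the prox, whose second coordinate is then both `ν'` and
  -- `ν`.
  · obtain ⟨s', hx', hη'⟩ := (exists_slope_iff hμ hν').2 h
    have hprox' := (isProx_perspective_expFun_interior hμ hν' hx' hη').prox_eq
    have := congrArg WithLp.snd (hprox'.symm.trans hprox)
    simpa using this
  · rw [hprox, hW]
    congr 1
    rw [← mul_assoc, mul_div_cancel₀ μ hν.ne']
    linarith
  · rw [hprox, hW, perspective_expFun_of_pos _ hν, mul_div_cancel_left₀ s hν.ne']
    congr 1
    field_simp

end PerspEpi

open PerspEpi in
theorem mainTheorem5 :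
    -- the exponential function belongs to `Γ₀(ℝ)`; its recession function
    IsGammaZero expFun ∧
    (∀ x₀ x : ℝ, Tendsto (fun t : ℝ => (expFun (x₀ + t • x) - expFun x₀) / (t : EReal)) atTop
      (𝓝 (recession expFun x))) ∧
    recession expFun = indicatorFun (Set.Iic 0) ∧
    -- its perspective
    (∀ x η : ℝ, perspective expFun (pair x η) =
      if 0 < η then ((η * Real.exp (x / η) : ℝ) : EReal)
      else if η = 0 then indicatorFun (Set.Iic 0) x
      else ⊤) ∧
    -- the epigraph of the perspective is the exponential cone
    epi (perspective expFun) = expCone ∧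
    -- the closure of the domain of the perspective, and the projection onto it
    closure (dom (perspective expFun)) = {z | 0 ≤ z.snd} ∧
    (∀ x η : ℝ,
      IsProx (indicatorFun (closure (dom (perspective expFun)))) (pair x η)
        (proj (closure (dom (perspective expFun))) (pair x η)) ∧
      proj (closure (dom (perspective expFun))) (pair x η) = pair x (max 0 η) ∧
      perspective expFun (proj (closure (dom (perspective expFun))) (pair x η)) =
        (if 0 < η then ((η * Real.exp (x / η) : ℝ) : EReal)
        else if x ≤ 0 then 0
        else ⊤)) ∧
    (∀ x η δ : ℝ,
      perspective expFun (proj (closure (dom (perspective expFun))) (pair x η)) ≤ (δ : EReal) ↔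
        (0 < η ∧ η * Real.exp (x / η) ≤ δ) ∨ (η ≤ 0 ∧ x ≤ 0 ∧ 0 ≤ δ)) ∧
    -- the projection onto the epigraph of the perspective
    (∀ x η δ : ℝ,
      IsProx (indicatorFun (epi (perspective expFun))) (pair (pair x η) δ)
        (proj (epi (perspective expFun)) (pair (pair x η) δ)) ∧
      (η ≤ 0 ∧ x ≤ 0 ∧ 0 ≤ δ →
        proj (epi (perspective expFun)) (pair (pair x η) δ) = pair (pair x 0) δ) ∧
      (0 < η ∧ η * Real.exp (x / η) ≤ δ →
        proj (epi (perspective expFun)) (pair (pair x η) δ) = pair (pair x η) δ) ∧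
      (¬ (η ≤ 0 ∧ x ≤ 0 ∧ 0 ≤ δ) → ¬ (0 < η ∧ η * Real.exp (x / η) ≤ δ) →
        ∃ μ : ℝ, 0 < μ ∧
          (μ : EReal) ≤ -(δ : EReal) +
            perspective expFun (proj (closure (dom (perspective expFun))) (pair x η)) ∧
          (μ : EReal) + (δ : EReal) -
            perspective expFun (prox (scaled μ (perspective expFun)) (pair x η)) = 0 ∧
          (∀ μ' : ℝ, 0 < μ' →
            (μ' : EReal) + (δ : EReal) -
              perspective expFun (prox (scaled μ' (perspective expFun)) (pair x η)) = 0 →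
            μ' = μ) ∧
          proj (epi (perspective expFun)) (pair (pair x η) δ) =
            pair (prox (scaled μ (perspective expFun)) (pair x η)) (δ + μ))) ∧
    -- the conjugate of the exponential function, its domain, the projection onto the closure
    -- of this domain
    (∀ ξ : ℝ, conjugate expFun ξ =
      if 0 < ξ then ((ξ * (Real.log ξ - 1) : ℝ) : EReal)
      else if ξ = 0 then 0
      else ⊤) ∧
    closure (dom (conjugate expFun)) = Set.Ici 0 ∧
    (∀ ξ : ℝ,
      IsProx (indicatorFun (closure (dom (conjugate expFun)))) ξ
        (proj (closure (dom (conjugate expFun))) ξ) ∧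
      proj (closure (dom (conjugate expFun))) ξ = max 0 ξ) ∧
    (∀ x η μ : ℝ, 0 < μ →
      ((η : EReal) + (μ : EReal) *
          conjugate expFun (proj (closure (dom (conjugate expFun))) (x / μ)) ≤ 0 ↔
        (x ≤ 0 ∧ η ≤ 0) ∨ (0 < x ∧ x * Real.exp (η / x - 1) ≤ μ))) ∧
    -- the proximity operators of multiples of the exponential function and of its conjugate
    (∀ γ x : ℝ, 0 < γ →
      IsProx (scaled γ expFun) x (prox (scaled γ expFun) x) ∧
      prox (scaled γ expFun) x = x - lambertW (γ * Real.exp x) ∧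
      expFun (prox (scaled γ expFun) x) =
        ((1 / γ * lambertW (γ * Real.exp x) : ℝ) : EReal) ∧
      IsProx (scaled γ (conjugate expFun)) x (prox (scaled γ (conjugate expFun)) x) ∧
      prox (scaled γ (conjugate expFun)) x = γ * lambertW (Real.exp (x / γ) / γ) ∧
      conjugate expFun (prox (scaled γ (conjugate expFun)) x) =
        (((x - γ) * lambertW (Real.exp (x / γ) / γ)
          - γ * lambertW (Real.exp (x / γ) / γ) ^ 2 : ℝ) : EReal)) ∧
    -- the proximity operator of multiples of the perspective
    (∀ x η μ : ℝ, 0 < μ →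
      IsProx (scaled μ (perspective expFun)) (pair x η)
        (prox (scaled μ (perspective expFun)) (pair x η)) ∧
      (0 < x ∧ x * Real.exp (η / x - 1) ≤ μ →
        prox (scaled μ (perspective expFun)) (pair x η) = pair 0 0 ∧
        perspective expFun (prox (scaled μ (perspective expFun)) (pair x η)) = 0) ∧
      (x ≤ 0 ∧ η ≤ 0 →
        prox (scaled μ (perspective expFun)) (pair x η) = pair x 0 ∧
        perspective expFun (prox (scaled μ (perspective expFun)) (pair x η)) = 0) ∧
      (¬ (0 < x ∧ x * Real.exp (η / x - 1) ≤ μ) → ¬ (x ≤ 0 ∧ η ≤ 0) →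
        ∃ ν : ℝ, 0 < ν ∧
          ν = η + (x - ν) * lambertW (μ / ν * Real.exp (x / ν))
            - ν * lambertW (μ / ν * Real.exp (x / ν)) ^ 2 ∧
          (∀ ν' : ℝ, 0 < ν' →
            ν' = η + (x - ν') * lambertW (μ / ν' * Real.exp (x / ν'))
              - ν' * lambertW (μ / ν' * Real.exp (x / ν')) ^ 2 →
            ν' = ν) ∧
          (0 < x → ν ≤ η + x * (Real.log (x / μ) - 1)) ∧
          (x ≤ 0 → ν ≤ η) ∧
          prox (scaled μ (perspective expFun)) (pair x η) =
            pair (x - ν * lambertW (μ / ν * Real.exp (x / ν))) ν ∧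
          perspective expFun (prox (scaled μ (perspective expFun)) (pair x η)) =
            ((ν ^ 2 / μ * lambertW (μ / ν * Real.exp (x / ν)) : ℝ) : EReal))) := by
  refine ⟨isGammaZero_expFun,
    fun x₀ x => by rw [recession_expFun]; exact tendsto_recession_quotient x₀ x,
    recession_expFun, fun x η => perspective_expFun (pair x η), epi_perspective_expFun,
    closure_dom_perspective_expFun, fun x η => ?_, fun x η δ => ?_, fun x η δ => ?_,
    conjugate_expFun, closure_dom_conjugate_expFun, fun ξ => ?_, fun x η μ hμ => ?_,
    fun γ x hγ => ?_, fun x η μ hμ => ?_⟩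
  · have h := isProx_closure_dom_perspective_expFun x η
    have he : proj (closure (dom (perspective expFun))) (pair x η) = pair x (max 0 η) := h.prox_eq
    exact ⟨h.isProx_prox, he, by rw [he, perspective_expFun_proj]⟩
  · have he : proj (closure (dom (perspective expFun))) (pair x η) = pair x (max 0 η) :=
      (isProx_closure_dom_perspective_expFun x η).prox_eq
    rw [he, perspective_expFun_proj_le_iff]
  · have he : proj (closure (dom (perspective expFun))) (pair x η) = pair x (max 0 η) :=
      (isProx_closure_dom_perspective_expFun x η).prox_eq
    obtain ⟨p, hp⟩ := exists_isProx_epi_perspective_expFun (pair (pair x η) δ)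
    refine ⟨hp.isProx_prox, fun h => (isProx_epi_perspective_boundary h.1 h.2.1 h.2.2).prox_eq,
      fun h => (isProx_indicatorFun_self (w := pair (pair x η) δ)
        (C := epi (perspective expFun)) ((perspective_expFun_le_coe_iff (pair x η) δ).2 (Or.inl h))).prox_eq, fun h1 h2 => ?_⟩
    rw [he]
    exact proj_epi_perspective_expFun h1 h2
  · have h := isProx_closure_dom_conjugate_expFun ξ
    exact ⟨h.isProx_prox, h.prox_eq⟩
  · have he : proj (closure (dom (conjugate expFun))) (x / μ) = max 0 (x / μ) :=
      (isProx_closure_dom_conjugate_expFun (x / μ)).prox_eq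
    rw [he, add_mul_conjugate_expFun_nonpos_iff x η hμ]
  · have h := isProx_scaled_expFun hγ x
    have h' := isProx_scaled_conjugate_expFun hγ x
    exact ⟨h.isProx_prox, h.prox_eq, by rw [h.prox_eq, expFun_prox hγ],
      h'.isProx_prox, h'.prox_eq, by rw [h'.prox_eq, conjugate_expFun_prox hγ]⟩
  · obtain ⟨p, hp⟩ := exists_isProx_perspective_expFun (x := x) (η := η) hμ
    refine ⟨hp.isProx_prox, fun h => ?_, fun h => ?_, prox_perspective_expFun_interior hμ⟩
    · have h' := (isProx_perspective_expFun_zero hμ h.1 h.2).prox_eq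
      exact ⟨h', by rw [h', perspective_expFun_zero le_rfl]⟩
    · have h' := (isProx_perspective_expFun_boundary hμ h.1 h.2).prox_eq
      exact ⟨h', by rw [h', perspective_expFun_zero h.1]⟩
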